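/- For $a,q\in\mathbb C$ and $n\ge 0$ let $(a)_n=(a;q)_n:=\prod_{k=0}^{n-1}(1-aq^k)$, for $|q|<1$ let $(a)_\infty=(a;q)_\infty:=\prod_{k\ge 0}(1-aq^k)$, and write $(a,b)_n=(a)_n(b)_n$, $(a,b)_\infty=(a)_\infty(b)_\infty$. Define the series $$g_{2,1}(w;q)=g_2(w;q):=\sum_{n\ge0}\frac{(-q)_n\,q^{n(n+1)/2}}{(w,w^{-1}q)_{n+1}},\qquad O_2(w;q):=\sum_{n\ge0}\frac{(-1)_n\,q^{n(n+1)/2}}{(wq,w^{-1}q)_n},$$ $$g_{2,2}(w;q):=\frac{1+w}{2w(1-w)}O_2(w;q)-\frac1{2w},\qquad g_{2,3}(w;q):=-\frac{1+w}{2w^2}\sum_{n\ge0}\frac{(-wq)_n}{(wq)_n}w^{-n}-\frac1{2w},$$ where the base of every symbol $(\cdot)_n$ is the second argument of the function. For $|q|<1$ define, with the Kronecker symbol $\left(\frac{12}{n}\right)$ (so that $\left(\frac{12}{0}\right)=0$), $$\psi_1(w;q):=-w-w^2\sum_{n\ge0}\left(\tfrac{12}{n}\right)w^{\frac{n-1}2}q^{\frac{n^2-1}{24}},\qquad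 \psi_3(w;q):=\sum_{n\ge0}(-1)^{n+1}w^{2n+1}q^{n^2},$$ $$\psi_4(w;q):=\sum_{n\ge1}w^{3n-2}q^{\frac{3n^2-n}2}(1-wq^n),$$ $$S_1(w;q):=\frac{(-q)_\infty}{(-w^{-1},-wq)_\infty}\left(w^{-1}\psi_1(w;q)+1\right),\qquad S_4(w;q):=\frac{(-q)_\infty}{(wq,w^{-1})_\infty}\psi_4(w;q),$$ where $w\ne0$ and $w\neq -q^\ell$ $(\ell\in\mathbb Z)$ in $S_1$, and $w\ne 0$ and $w\neq q^\ell$ $(\ell\in\mathbb Z)$ in $S_4$. Theorem. Let $0<|q|<1$. (i) For every $w\in\mathbb C\setminus\{0\}$ with $w\ne q^\ell$ for all $\ell\in\mathbb Z$, the series defining $g_{2,1}(w;q^{-1})$ and $O_2(w;q^{-1})$ converge absolutely, and $$g_{2,1}(w;q^{-1})=-w^{-2}\psi_3(w;q)-w^{-1}+S_4(w;q),\qquad g_{2,2}(w;q^{-1})=\psi_3(w^{-1};q)+S_1(-w^{-1};q).$$ (ii) For every $w\in\mathbb C$ with $|w|>1$ and $w\ne q^\ell$ for all integers $\ell\ge1$,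 the series in $g_{2,3}(w;q^{-1})$ converges absolutely, and $$g_{2,3}(w;q^{-1})=\psi_3(w^{-1};q).$$ -/

import Mathlib

open scoped BigOperators

noncomputable section

/-- The finite `q`-Pochhammer symbol `(a; q)_n = ∏_{k=0}^{n-1} (1 - a q^k)`, for any base `q`. -/
def qPoch (a q : ℂ) (n : ℕ) : ℂ := ∏ k ∈ Finset.range n, (1 - a * q ^ k)

/-- The infinite `q`-Pochhammer symbol `(a; q)_∞ = ∏_{k ≥ 0} (1 - a q^k)`, used for `|q| < 1`. -/
def qPochInf (a q : ℂ) : ℂ := ∏' k : ℕ, (1 - a * q ^ k)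

/-- `n`-th term of `g_2(w; q)`. -/
def g2Term (w q : ℂ) (n : ℕ) : ℂ :=
  qPoch (-q) q n * q ^ (n * (n + 1) / 2) / (qPoch w q (n + 1) * qPoch (w⁻¹ * q) q (n + 1))

/-- The universal mock theta series `g_2(w; q) = g_{2,1}(w; q)`. -/
def g21 (w q : ℂ) : ℂ := ∑' n : ℕ, g2Term w q n

/-- `n`-th term of the overpartition rank generating function `O_2(w; q)`. -/
def O2Term (w q : ℂ) (n : ℕ) : ℂ :=
  qPoch (-1) q n * q ^ (n * (n + 1) / 2) / (qPoch (w * q) q n * qPoch (w⁻¹ * q) q n)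

/-- The overpartition rank generating function `O_2(w; q)`. -/
def O2 (w q : ℂ) : ℂ := ∑' n : ℕ, O2Term w q n

/-- `g_{2,2}(w; q)`. -/
def g22 (w q : ℂ) : ℂ := (1 + w) / (2 * w * (1 - w)) * O2 w q - 1 / (2 * w)

/-- `n`-th term of the series in `g_{2,3}(w; q)`. -/
def g23Term (w q : ℂ) (n : ℕ) : ℂ :=
  qPoch (-(w * q)) q n / qPoch (w * q) q n * (w⁻¹) ^ n

/-- `g_{2,3}(w; q)`. -/
def g23 (w q : ℂ) : ℂ := -((1 + w) / (2 * w ^ 2)) * (∑' n : ℕ, g23Term w q n) - 1 / (2 * w)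

/-- The Kronecker symbol `(12 / n)` for `n ≥ 0`. For `n ≥ 1` it agrees with Mathlib's
`jacobiSym 12 n` (both vanish at even `n`); at `n = 0` the Kronecker symbol is `0`. -/
def kronecker12 (n : ℕ) : ℤ := if n = 0 then 0 else jacobiSym 12 n

/-- `n`-th term of the series in `ψ_1(w; q)`. The exponents `(n-1)/2` and `(n²-1)/24` are
natural numbers whenever `(12 / n) ≠ 0`. -/
def psi1Term (w q : ℂ) (n : ℕ) : ℂ :=
  (kronecker12 n : ℂ) * w ^ ((n - 1) / 2) * q ^ ((n ^ 2 - 1) / 24)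

/-- `ψ_1(w; q) = -w - w² ∑_{n ≥ 0} (12 / n) w^{(n-1)/2} q^{(n²-1)/24}`. -/
def psi1 (w q : ℂ) : ℂ := -w - w ^ 2 * ∑' n : ℕ, psi1Term w q n

/-- `n`-th term of the partial theta function `ψ_3(w; q)`. -/
def psi3Term (w q : ℂ) (n : ℕ) : ℂ := (-1) ^ (n + 1) * w ^ (2 * n + 1) * q ^ (n ^ 2)

/-- `ψ_3(w; q) = ∑_{n ≥ 0} (-1)^{n+1} w^{2n+1} q^{n²}`. -/
def psi3 (w q : ℂ) : ℂ := ∑' n : ℕ, psi3Term w q n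

/-- The term `w^{3n-2} q^{(3n²-n)/2} (1 - w q^n)` of `ψ_4(w; q)`, meant for `n ≥ 1`. -/
def psi4Term (w q : ℂ) (n : ℕ) : ℂ :=
  w ^ (3 * n - 2) * q ^ ((3 * n ^ 2 - n) / 2) * (1 - w * q ^ n)

/-- `ψ_4(w; q) = ∑_{n ≥ 1} w^{3n-2} q^{(3n²-n)/2} (1 - w q^n)`. -/
def psi4 (w q : ℂ) : ℂ := ∑' n : ℕ, psi4Term w q (n + 1)

/-- `S_1(w; q) = (-q)_∞ / (-w⁻¹, -wq)_∞ * (w⁻¹ ψ_1(w; q) + 1)`. -/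
def S1 (w q : ℂ) : ℂ :=
  qPochInf (-q) q / (qPochInf (-w⁻¹) q * qPochInf (-(w * q)) q) * (w⁻¹ * psi1 w q + 1)

/-- `S_4(w; q) = (-q)_∞ / (wq, w⁻¹)_∞ * ψ_4(w; q)`. -/
def S4 (w q : ℂ) : ℂ :=
  qPochInf (-q) q / (qPochInf (w * q) q * qPochInf w⁻¹ q) * psi4 w q

end

/-! Convergence of the infinite products and of the partial theta series for `|q| < 1`, so that
the definitions above never take a default value there. -/

theorem qPochInf_multipliable (a : ℂ) {q : ℂ} (hq : ‖q‖ < 1) :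
    Multipliable (fun k : ℕ => 1 - a * q ^ k) := by
  have h : Summable (fun k : ℕ => ‖-(a * q ^ k)‖) := by
    simp only [norm_neg, norm_mul, norm_pow]
    exact (summable_geometric_of_lt_one (norm_nonneg q) hq).mul_left _
  simpa [sub_eq_add_neg] using multipliable_one_add_of_summable h

theorem summable_pow_mul_pow_aux {M r : ℝ} (hM : 0 ≤ M) (hr : 0 ≤ r) (hr1 : r < 1) (e : ℕ → ℕ)
    (he : ∀ K : ℕ, ∀ᶠ n in Filter.atTop, K * n ≤ e n) :
    Summable (fun n : ℕ => M ^ n * r ^ e n) := by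
  have ht : Filter.Tendsto (fun K : ℕ => M * r ^ K) Filter.atTop (nhds 0) := by
    simpa using (tendsto_pow_atTop_nhds_zero_of_lt_one hr hr1).const_mul M
  obtain ⟨K, hK⟩ := (ht.eventually (gt_mem_nhds (show (0 : ℝ) < 1 / 2 by norm_num))).exists
  refine Summable.of_norm_bounded_eventually_nat (g := fun n : ℕ => (1 / 2 : ℝ) ^ n)
    (summable_geometric_of_lt_one (by norm_num) (by norm_num)) ?_
  filter_upwards [he K] with n hn
  rw [Real.norm_of_nonneg (by positivity)]
  calc M ^ n * r ^ e n ≤ M ^ n * r ^ (K * n) := by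
        exact mul_le_mul_of_nonneg_left (pow_le_pow_of_le_one hr hr1.le hn) (by positivity)
    _ = (M * r ^ K) ^ n := by rw [mul_pow, pow_mul]
    _ ≤ (1 / 2) ^ n := pow_le_pow_left₀ (by positivity) hK.le n

theorem kronecker12_norm_le (n : ℕ) : ‖(kronecker12 n : ℂ)‖ ≤ 1 := by
  unfold kronecker12
  split_ifs
  · simp
  · rcases jacobiSym.trichotomy 12 n with h | h | h <;> simp [h]

theorem psi1Term_summable (w : ℂ) {q : ℂ} (hq : ‖q‖ < 1) : Summable (psi1Term w q) := by
  have h := summable_pow_mul_pow_aux (M := max 1 ‖w‖) (by positivity) (norm_nonneg q) hq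
    (fun n => (n ^ 2 - 1) / 24) (by
      intro K
      filter_upwards [Filter.eventually_ge_atTop (24 * K + 1)] with n hn
      rw [Nat.le_div_iff_mul_le (by norm_num)]
      apply Nat.le_sub_of_add_le
      nlinarith)
  refine Summable.of_norm_bounded h (fun n => ?_)
  simp only [psi1Term, norm_mul, norm_pow]
  gcongr
  calc ‖(kronecker12 n : ℂ)‖ * ‖w‖ ^ ((n - 1) / 2)
      ≤ 1 * (max 1 ‖w‖) ^ ((n - 1) / 2) := by
        gcongr
        · exact kronecker12_norm_le n
        · exact le_max_right _ _
    _ ≤ (max 1 ‖w‖) ^ n := by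
        rw [one_mul]
        exact pow_le_pow_right₀ (le_max_left _ _) (by omega)

theorem psi3Term_summable (w : ℂ) {q : ℂ} (hq : ‖q‖ < 1) : Summable (psi3Term w q) := by
  have h := (summable_pow_mul_pow_aux (M := ‖w‖ ^ 2) (by positivity) (norm_nonneg q) hq
    (fun n => n ^ 2) (by
      intro K
      filter_upwards [Filter.eventually_ge_atTop K] with n hn
      nlinarith)).mul_left ‖w‖
  refine Summable.of_norm_bounded h (fun n => le_of_eq ?_)
  simp only [psi3Term, norm_mul, norm_pow, norm_neg, norm_one, one_pow]
  ring

theorem psi4Term_summable (w : ℂ) {q : ℂ} (hq : ‖q‖ < 1) :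
    Summable (fun n : ℕ => psi4Term w q (n + 1)) := by
  have h := (summable_pow_mul_pow_aux (M := ‖w‖ ^ 3) (by positivity) (norm_nonneg q) hq
    (fun n => (3 * (n + 1) ^ 2 - (n + 1)) / 2) (by
      intro K
      filter_upwards [Filter.eventually_ge_atTop K] with n hn
      rw [Nat.le_div_iff_mul_le (by norm_num)]
      apply Nat.le_sub_of_add_le
      nlinarith)).mul_left (‖w‖ * (1 + ‖w‖))
  refine Summable.of_norm_bounded h (fun n => ?_)
  have h1 : ‖1 - w * q ^ (n + 1)‖ ≤ 1 + ‖w‖ := by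
    refine (norm_sub_le _ _).trans ?_
    rw [norm_one, norm_mul, norm_pow]
    have := mul_le_mul_of_nonneg_left (pow_le_one₀ (n := n + 1) (norm_nonneg q) hq.le)
      (norm_nonneg w)
    linarith
  have h2 : 3 * (n + 1) - 2 = 3 * n + 1 := by omega
  simp only [psi4Term, norm_mul, norm_pow, h2]
  calc _ ≤ ‖w‖ ^ (3 * n + 1) * ‖q‖ ^ ((3 * (n + 1) ^ 2 - (n + 1)) / 2) * (1 + ‖w‖) := by gcongr
    _ = _ := by ring

/-!
Passing from base `q⁻¹` to base `q` (`qPoch_inv_base`) turns the three series into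

* `f(w) = ∑ q^{n+1} (-q)_n / ((w⁻¹)_{n+1} (wq)_{n+1})` (`gTerm`),
* `∑ q^n (-1)_n / ((z⁻¹q)_n (z)_{n+1})` with `z = w⁻¹` (`oTerm`),
* `∑ (-z)^n (-zq)_n / (zq)_n` with `z = w⁻¹` (`rTerm`),

of which the first two converge geometrically with ratio `|q|` and the third with ratio `|z|`.

Each of them, suitably normalised, satisfies a first order inhomogeneous `q`-difference equation
(`tsum_gTerm_add`, `oSum_add`, `rSum_add`). For instance, with `θ(w) = (wq, w⁻¹)_∞`,
`f(w) + w² q² f(wq) = wq (1 - wq) (-q)_∞ / θ(w) - wq`. The reason is that the `n`-th term of the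
left side is the difference `t_{n+1} - t_n` of
`t_n = wq (1 - wq) (-q)_n / ((w⁻¹)_n (wq)_{n+1})`, which starts at `wq` and tends to the theta
quotient on the right; the other two equations have similar certificates.

Iterating these equations along `w, wq, wq², …` and using `θ(w) = -wq θ(wq)`
(`qTheta_eq_shift_pow`), the polynomial inhomogeneities add up to `ψ_3`, and the theta quotients
to a multiple of `ψ_4` for the first series and of `ψ_1` for the second (`tsum_gTerm_eq`,
`oSum_eq`). The third equation has no theta quotient, so that only `ψ_3` is left (`rSum_eq`). The
remainder after `N` steps tends to zero: it carries a factor `q^{N²}`, whereas the series at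
`w q^N` grow at most geometrically in `N`, since the denominators satisfy
`|(a q^{-N})_n| ≥ c δ^N` (`exists_le_norm_qPoch_mul_inv_pow`).
-/

open Filter Topology

/-! ### Avoiding the integral powers of `q` -/

theorem mul_pow_ne_one_of_forall_ne_zpow {w q : ℂ} (h : ∀ l : ℤ, w ≠ q ^ l) (k : ℕ) :
    w * q ^ k ≠ 1 := fun hk => h (-(k : ℤ)) (by
  rw [zpow_neg, zpow_natCast]; exact eq_inv_of_mul_eq_one_left hk)

theorem inv_mul_pow_ne_one_of_forall_ne_zpow {w q : ℂ} (hw : w ≠ 0) (h : ∀ l : ℤ, w ≠ q ^ l)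
    (k : ℕ) : w⁻¹ * q ^ k ≠ 1 := fun hk => h k (by
  rw [zpow_natCast, ← mul_inv_cancel_left₀ hw (q ^ k), hk, mul_one])

theorem mul_pow_ne_zpow {w q : ℂ} (hq0 : q ≠ 0) (h : ∀ l : ℤ, w ≠ q ^ l) (N : ℕ) (l : ℤ) :
    w * q ^ N ≠ q ^ l := fun hl => h (l - N) (by
  rw [zpow_sub₀ hq0, zpow_natCast, ← hl, mul_div_cancel_right₀ _ (pow_ne_zero _ hq0)])

theorem inv_ne_zpow {w q : ℂ} (h : ∀ l : ℤ, w ≠ q ^ l) (l : ℤ) : w⁻¹ ≠ q ^ l := fun hl =>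
  h (-l) (by rw [zpow_neg, ← hl, inv_inv])

/-! ### Finite and infinite `q`-Pochhammer symbols -/

theorem qPoch_zero (a q : ℂ) : qPoch a q 0 = 1 := by simp [qPoch]

theorem qPoch_succ (a q : ℂ) (n : ℕ) : qPoch a q (n + 1) = qPoch a q n * (1 - a * q ^ n) := by
  simp [qPoch, Finset.prod_range_succ]

theorem qPoch_succ' (a q : ℂ) (n : ℕ) : qPoch a q (n + 1) = (1 - a) * qPoch (a * q) q n := by
  simp only [qPoch, Finset.prod_range_succ', pow_zero, mul_one, pow_succ']
  rw [mul_comm]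
  simp only [mul_assoc]

theorem qPoch_add (a q : ℂ) (m n : ℕ) :
    qPoch a q (m + n) = qPoch a q m * qPoch (a * q ^ m) q n := by
  simp [qPoch, Finset.prod_range_add, pow_add, mul_assoc]

theorem qPoch_ne_zero {a q : ℂ} (h : ∀ k : ℕ, a * q ^ k ≠ 1) (n : ℕ) : qPoch a q n ≠ 0 :=
  Finset.prod_ne_zero_iff.2 fun k _ => sub_ne_zero.2 (h k).symm

theorem tendsto_qPoch (a : ℂ) {q : ℂ} (hq : ‖q‖ < 1) :
    Tendsto (qPoch a q) atTop (𝓝 (qPochInf a q)) :=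
  (qPochInf_multipliable a hq).hasProd.tendsto_prod_nat

theorem qPochInf_ne_zero {a q : ℂ} (hq : ‖q‖ < 1) (h : ∀ k : ℕ, a * q ^ k ≠ 1) :
    qPochInf a q ≠ 0 := by
  have hs : Summable (fun k : ℕ => ‖-(a * q ^ k)‖) := by
    simp only [norm_neg, norm_mul, norm_pow]
    exact (summable_geometric_of_lt_one (norm_nonneg q) hq).mul_left _
  have := tprod_one_add_ne_zero_of_summable (f := fun k : ℕ => -(a * q ^ k))
    (fun k => by rw [← sub_eq_add_neg]; exact sub_ne_zero.2 (h k).symm) hs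
  simpa [qPochInf, sub_eq_add_neg] using this

theorem qPochInf_shift (a : ℂ) {q : ℂ} (hq : ‖q‖ < 1) :
    qPochInf a q = (1 - a) * qPochInf (a * q) q := by
  refine tendsto_nhds_unique ((tendsto_qPoch a hq).comp (tendsto_add_atTop_nat 1)) ?_
  refine ((tendsto_qPoch (a * q) hq).const_mul (1 - a)).congr fun n => ?_
  exact (qPoch_succ' a q n).symm

theorem exists_norm_qPoch_le (a : ℂ) {q : ℂ} (hq : ‖q‖ < 1) :
    ∃ C : ℝ, 0 < C ∧ ∀ n, ‖qPoch a q n‖ ≤ C := by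
  obtain ⟨C, hC⟩ := (tendsto_qPoch a hq).norm.bddAbove_range
  exact ⟨max C 1, by positivity, fun n => (hC ⟨n, rfl⟩).trans (le_max_left _ _)⟩

theorem exists_le_norm_qPoch {a q : ℂ} (hq : ‖q‖ < 1) (h : ∀ k : ℕ, a * q ^ k ≠ 1) :
    ∃ c : ℝ, 0 < c ∧ ∀ n, c ≤ ‖qPoch a q n‖ := by
  have ht := ((tendsto_qPoch a hq).inv₀ (qPochInf_ne_zero hq h)).norm
  obtain ⟨C, hC⟩ := ht.bddAbove_range
  refine ⟨(max C 1)⁻¹, by positivity, fun n => ?_⟩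
  have h1 : ‖(qPoch a q n)⁻¹‖ ≤ max C 1 := (hC ⟨n, rfl⟩).trans (le_max_left _ _)
  rw [norm_inv] at h1
  exact inv_le_of_inv_le₀ (norm_pos_iff.2 (qPoch_ne_zero h n)) h1

/-- The symbols `(a q^N)_n` are bounded away from zero uniformly in `N` and `n`. -/
theorem exists_le_norm_qPoch_mul_pow {a q : ℂ} (hq : ‖q‖ < 1) (h : ∀ k : ℕ, a * q ^ k ≠ 1) :
    ∃ c : ℝ, 0 < c ∧ ∀ N n, c ≤ ‖qPoch (a * q ^ N) q n‖ := by
  obtain ⟨c, hc, hc'⟩ := exists_le_norm_qPoch hq h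
  obtain ⟨C, hC, hC'⟩ := exists_norm_qPoch_le a hq
  refine ⟨c / C, by positivity, fun N n => ?_⟩
  have h1 := hc' (N + n)
  rw [qPoch_add, norm_mul] at h1
  rw [div_le_iff₀' hC]
  exact h1.trans (mul_le_mul_of_nonneg_right (hC' N) (norm_nonneg _))

/-- The symbols `(a q^{-N})_n` stay away from zero, up to a factor that is geometric in `N`. -/
theorem exists_le_norm_qPoch_mul_inv_pow {a q : ℂ} (hq0 : q ≠ 0) (hq : ‖q‖ < 1) (ha : a ≠ 0)
    (h : ∀ l : ℤ, a ≠ q ^ l) :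
    ∃ c δ : ℝ, 0 < c ∧ 0 < δ ∧ ∀ N n, c * δ ^ N ≤ ‖qPoch (a * (q ^ N)⁻¹) q n‖ := by
  obtain ⟨c, hc, hc'⟩ := exists_le_norm_qPoch hq
    (mul_pow_ne_one_of_forall_ne_zpow h)
  obtain ⟨d, hd, hd'⟩ := exists_le_norm_qPoch_mul_pow hq
    (inv_mul_pow_ne_one_of_forall_ne_zpow ha h)
  have ha' : 0 < ‖a‖ := norm_pos_iff.2 ha
  -- A single factor is bounded below: `1 - a q^{-m} = -a q^{-m} (1 - a⁻¹ q^m)`.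
  have hfac : ∀ m : ℕ, ‖a‖ * d ≤ ‖1 - a * (q ^ m)⁻¹‖ := fun m => by
    have hm := hd' m 1
    simp only [qPoch, Finset.prod_range_one, pow_zero, mul_one] at hm
    have hqm : q ^ m ≠ 0 := pow_ne_zero _ hq0
    have : 1 - a * (q ^ m)⁻¹ = -(a * (q ^ m)⁻¹ * (1 - a⁻¹ * q ^ m)) := by
      field_simp
      ring
    rw [this, norm_neg, norm_mul, norm_mul]
    have h3 : 1 ≤ ‖(q ^ m)⁻¹‖ := by
      rw [norm_inv, norm_pow]
      exact (one_le_inv₀ (by positivity)).2 (pow_le_one₀ (norm_nonneg _) hq.le)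
    gcongr
    exact le_mul_of_one_le_right ha'.le h3
  refine ⟨min c 1, min (‖a‖ * d) 1, by positivity, by positivity, fun N => ?_⟩
  induction N with
  | zero => intro n; simpa using Or.inl (hc' n)
  | succ N ih =>
    rintro (_ | n)
    · rw [qPoch_zero, norm_one]
      exact mul_le_one₀ (min_le_right _ _) (by positivity)
        (pow_le_one₀ (by positivity) (min_le_right _ _))
    · have h4 : a * (q ^ (N + 1))⁻¹ * q = a * (q ^ N)⁻¹ := by
        rw [pow_succ]; field_simp
      rw [qPoch_succ', h4, norm_mul, pow_succ', mul_left_comm]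
      exact mul_le_mul ((min_le_left _ _).trans (hfac _)) (ih n) (by positivity) (norm_nonneg _)

/-! ### The theta product `(wq, w⁻¹)_∞` -/

/-- The product `(wq, w⁻¹)_∞`, a theta function up to the factor `(q)_∞`. -/
noncomputable def qTheta (w q : ℂ) : ℂ := qPochInf (w * q) q * qPochInf w⁻¹ q

theorem qTheta_ne_zero {w q : ℂ} (hq : ‖q‖ < 1) (hw : w ≠ 0) (h : ∀ l : ℤ, w ≠ q ^ l) :
    qTheta w q ≠ 0 := by
  refine mul_ne_zero (qPochInf_ne_zero hq fun k => ?_)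
    (qPochInf_ne_zero hq (inv_mul_pow_ne_one_of_forall_ne_zpow hw h))
  rw [mul_assoc, ← pow_succ']
  exact mul_pow_ne_one_of_forall_ne_zpow h _

theorem qTheta_eq_shift {w q : ℂ} (hq0 : q ≠ 0) (hq : ‖q‖ < 1) (hw : w ≠ 0) :
    qTheta w q = -(w * q) * qTheta (w * q) q := by
  have h1 := qPochInf_shift (w * q) hq
  have h2 := qPochInf_shift (w * q)⁻¹ hq
  have h3 : (w * q)⁻¹ * q = w⁻¹ := by field_simp
  rw [h3] at h2
  rw [qTheta, qTheta, h1, h2]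
  field_simp
  ring

/-- Quasi-periodicity of `qTheta`; the exponent of `q` is `N (N + 1) / 2`. -/
theorem qTheta_eq_shift_pow {w q : ℂ} (hq0 : q ≠ 0) (hq : ‖q‖ < 1) (hw : w ≠ 0) (N : ℕ) :
    qTheta w q = (-w) ^ N * q ^ (N * (N + 1) / 2) * qTheta (w * q ^ N) q := by
  induction N with
  | zero => simp
  | succ N ih =>
    have h1 : (N + 1) * (N + 1 + 1) / 2 = N * (N + 1) / 2 + (N + 1) := by
      rw [show (N + 1) * (N + 1 + 1) = N * (N + 1) + (N + 1) * 2 by ring]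
      omega
    rw [ih, qTheta_eq_shift hq0 hq (mul_ne_zero hw (pow_ne_zero N hq0)), h1, mul_assoc w,
      ← pow_succ]
    ring

/-! ### Telescoping sums and quadratic exponents -/

/-- Telescoping: the sum of the differences of a convergent sequence. -/
theorem tsum_eq_sub_of_telescoping {s t : ℕ → ℂ} {L : ℂ} (hs : Summable s)
    (h : ∀ n, s n = t (n + 1) - t n) (ht : Tendsto t atTop (𝓝 L)) : ∑' n, s n = L - t 0 := by
  refine tendsto_nhds_unique hs.hasSum.tendsto_sum_nat ((ht.sub_const (t 0)).congr fun n => ?_)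
  rw [Finset.sum_congr rfl fun i _ => h i, Finset.sum_range_sub]

/-- Quadratic exponents beat geometric growth. -/
theorem tendsto_pow_mul_pow_quadratic {M r : ℝ} (hM : 0 ≤ M) (hr : 0 ≤ r) (hr1 : r < 1) :
    Tendsto (fun N : ℕ => M ^ N * r ^ (N ^ 2)) atTop (𝓝 0) := by
  refine (summable_pow_mul_pow_aux hM hr hr1 (fun n => n ^ 2) fun K => ?_).tendsto_atTop_zero
  filter_upwards [eventually_ge_atTop K] with n hn
  nlinarith

/-! ### Uniform bounds along `w, wq, wq², …` -/

/-- Along `w q^N` the terms of the series grow at most geometrically in `N`, which the factor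
`q ^ (N ^ 2)` coming from the iterated `q`-difference equation outweighs. -/
theorem exists_norm_qPoch_div_le (x : ℂ) {a b q : ℂ} (hq0 : q ≠ 0) (hq : ‖q‖ < 1) (ha : a ≠ 0)
    (h : ∀ l : ℤ, a ≠ q ^ l) (hb : ∀ k : ℕ, b * q ^ k ≠ 1) :
    ∃ K D : ℝ, 0 ≤ K ∧ 0 ≤ D ∧ ∀ N n i j : ℕ,
      ‖qPoch x q n / (qPoch (a * (q ^ N)⁻¹) q i * qPoch (b * q ^ N) q j)‖ ≤ K * D ^ N := by
  obtain ⟨C, hC, hC'⟩ := exists_norm_qPoch_le x hq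
  obtain ⟨c, δ, hc, hδ, h1⟩ := exists_le_norm_qPoch_mul_inv_pow hq0 hq ha h
  obtain ⟨d, hd, h2⟩ := exists_le_norm_qPoch_mul_pow hq hb
  refine ⟨C / (c * d), δ⁻¹, by positivity, by positivity, fun N n i j => ?_⟩
  rw [norm_div, norm_mul]
  calc _ ≤ C / (c * δ ^ N * d) := by
        gcongr
        exacts [hC' n, h1 N i, h2 N j]
    _ = _ := by rw [inv_pow]; field_simp

theorem norm_tsum_le_of_le_geometric {s : ℕ → ℂ} {K r : ℝ} (hr : 0 ≤ r) (hr1 : r < 1)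
    (h : ∀ n, ‖s n‖ ≤ K * r ^ n) : ‖∑' n, s n‖ ≤ K * (1 - r)⁻¹ :=
  tsum_of_norm_bounded ((hasSum_geometric_of_lt_one hr hr1).mul_left K) h

theorem summable_of_le_geometric {s : ℕ → ℂ} {K r : ℝ} (hr : 0 ≤ r) (hr1 : r < 1)
    (h : ∀ n, ‖s n‖ ≤ K * r ^ n) : Summable s :=
  Summable.of_norm_bounded ((summable_geometric_of_lt_one hr hr1).mul_left K) h

theorem tendsto_pow_mul_pow_sq_mul {F : ℕ → ℂ} {K D : ℝ} (hD : 0 ≤ D) (c : ℂ) {q : ℂ}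
    (hq : ‖q‖ < 1) (h : ∀ N, ‖F N‖ ≤ K * D ^ N) :
    Tendsto (fun N : ℕ => c ^ N * q ^ (N ^ 2) * F N) atTop (𝓝 0) := by
  have h0 := (tendsto_pow_mul_pow_quadratic (M := ‖c‖ * D) (by positivity) (norm_nonneg q)
    hq).const_mul K
  rw [mul_zero] at h0
  refine squeeze_zero_norm (fun N => ?_) h0
  rw [norm_mul, norm_mul, norm_pow, norm_pow, mul_pow]
  calc _ ≤ ‖c‖ ^ N * ‖q‖ ^ (N ^ 2) * (K * D ^ N) := by gcongr; exact h N
    _ = _ := by ring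

/-! ### The series `g_{2,1}(w; q⁻¹)` in base `q` -/

/-- `n`-th term of `g_{2,1}(w; q⁻¹)`, rewritten in base `q`. -/
noncomputable def gTerm (w q : ℂ) (n : ℕ) : ℂ :=
  q ^ (n + 1) * (qPoch (-q) q n / (qPoch w⁻¹ q (n + 1) * qPoch (w * q) q (n + 1)))

theorem exists_norm_gTerm_le {w q : ℂ} (hq0 : q ≠ 0) (hq : ‖q‖ < 1) (hw : w ≠ 0)
    (h : ∀ l : ℤ, w ≠ q ^ l) :
    ∃ K D : ℝ, 0 ≤ K ∧ 0 ≤ D ∧ ∀ N n : ℕ, ‖gTerm (w * q ^ N) q n‖ ≤ K * D ^ N * ‖q‖ ^ n := by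
  obtain ⟨K, D, hK, hD, hb⟩ := exists_norm_qPoch_div_le (-q) hq0 hq (inv_ne_zero hw)
    (inv_ne_zpow h) (b := w * q) fun k => by
      rw [mul_assoc, ← pow_succ']; exact mul_pow_ne_one_of_forall_ne_zpow h _
  refine ⟨K, D, hK, hD, fun N n => ?_⟩
  rw [gTerm, norm_mul, norm_pow, mul_inv, mul_right_comm w, mul_comm]
  have := hb N n (n + 1) (n + 1)
  exact mul_le_mul this (pow_le_pow_of_le_one (norm_nonneg _) hq.le n.le_succ) (by positivity)
    (by positivity)

theorem summable_gTerm {w q : ℂ} (hq0 : q ≠ 0) (hq : ‖q‖ < 1) (hw : w ≠ 0)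
    (h : ∀ l : ℤ, w ≠ q ^ l) : Summable (gTerm w q) := by
  obtain ⟨K, D, hK, hD, hb⟩ := exists_norm_gTerm_le hq0 hq hw h
  exact summable_of_le_geometric (K := K) (norm_nonneg q) hq fun n => by simpa using hb 0 n

/-- The first order `q`-difference equation of `∑ gTerm`. -/
theorem tsum_gTerm_add {w q : ℂ} (hq0 : q ≠ 0) (hq : ‖q‖ < 1) (hw : w ≠ 0)
    (h : ∀ l : ℤ, w ≠ q ^ l) :
    ∑' n, gTerm w q n + w ^ 2 * q ^ 2 * ∑' n, gTerm (w * q) q n =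
      w * q * (1 - w * q) * qPochInf (-q) q / qTheta w q - w * q := by
  have h' : ∀ l : ℤ, w * q ≠ q ^ l := by simpa using mul_pow_ne_zpow hq0 h 1
  have hs := summable_gTerm hq0 hq hw h
  have hs' := (summable_gTerm hq0 hq (mul_ne_zero hw hq0) h').mul_left (w ^ 2 * q ^ 2)
  rw [← tsum_mul_left, ← hs.tsum_add hs']
  have hA := inv_mul_pow_ne_one_of_forall_ne_zpow hw h
  have hB : ∀ k : ℕ, w * q * q ^ k ≠ 1 := mul_pow_ne_one_of_forall_ne_zpow h'
  have h1 : 1 - w * q ≠ 0 := sub_ne_zero.2 (by simpa using (hB 0).symm)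
  rw [tsum_eq_sub_of_telescoping (hs.add hs')
    (t := fun n => w * q * (1 - w * q) * qPoch (-q) q n /
      (qPoch (w * q) q (n + 1) * qPoch w⁻¹ q n))
    (L := w * q * (1 - w * q) * qPochInf (-q) q / qTheta w q) ?tele ?lim]
  · simp only [qPoch_succ, qPoch_zero, pow_zero, mul_one, one_mul, zero_add]
    field_simp
  case tele =>
    intro n
    have e1 : qPoch (w * q) q (n + 1) = (1 - w * q) * qPoch (w * q * q) q n := qPoch_succ' _ _ _
    have e2 : qPoch (w * q) q (n + 1 + 1) =
        (1 - w * q) * (qPoch (w * q * q) q n * (1 - w * q * q * q ^ n)) := by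
      rw [qPoch_succ' _ _ (n + 1), qPoch_succ]
    have e3 : qPoch (w * q)⁻¹ q (n + 1) = (1 - (w * q)⁻¹) * qPoch w⁻¹ q n := by
      rw [qPoch_succ', show (w * q)⁻¹ * q = w⁻¹ by field_simp]
    have n1 : qPoch w⁻¹ q n ≠ 0 := qPoch_ne_zero hA n
    have n2 : qPoch (w * q * q) q n ≠ 0 := qPoch_ne_zero (fun k => by
      rw [mul_assoc _ q, ← pow_succ']; exact hB _) n
    have n3 : w - q ^ n ≠ 0 := by
      rw [sub_ne_zero]; intro hn; exact h n (by simpa using hn)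
    have n4 : 1 - w * q ^ 2 * q ^ n ≠ 0 := by
      rw [mul_assoc, ← pow_add]
      exact sub_ne_zero.2 (mul_pow_ne_one_of_forall_ne_zpow h _).symm
    have n5 : 1 - (w * q)⁻¹ = -((1 - w * q) / (w * q)) := by field_simp; ring
    have n6 : 1 - w⁻¹ * q ^ n = (w - q ^ n) / w := by field_simp
    have n7 : 1 - w * q * q * q ^ n = 1 - w * q ^ 2 * q ^ n := by ring
    simp only [gTerm, e2, e3, n5, n7, qPoch_succ w⁻¹, qPoch_succ (-q), n6,
      qPoch_succ (w * q * q), e1, pow_succ q n]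
    generalize qPoch w⁻¹ q n = A at *
    generalize qPoch (w * q * q) q n = B at *
    generalize qPoch (-q) q n = P at *
    generalize q ^ n = x at *
    generalize hE : 1 - w * q = E at *
    generalize hG : 1 - w * q ^ 2 * x = G at *
    generalize hH : w - x = H at *
    field_simp
    rw [← hE, ← hG, ← hH]
    ring
  case lim =>
    exact ((tendsto_qPoch (-q) hq).const_mul _).div (((tendsto_qPoch (w * q) hq).comp
      (tendsto_add_atTop_nat 1)).mul (tendsto_qPoch w⁻¹ hq)) (qTheta_ne_zero hq hw h)

/-- Iteration of `tsum_gTerm_add` along `w, wq, wq², …`: the inhomogeneous terms add up to the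
partial theta functions `ψ_3` and `ψ_4`. -/
theorem tsum_gTerm_eq {w q : ℂ} (hq0 : q ≠ 0) (hq : ‖q‖ < 1) (hw : w ≠ 0)
    (h : ∀ l : ℤ, w ≠ q ^ l) :
    ∑' n, gTerm w q n = -(w ^ 2)⁻¹ * psi3 w q - w⁻¹ + S4 w q := by
  set C := qPochInf (-q) q / qTheta w q with hC
  have hθ := qTheta_ne_zero hq hw h
  have s3 := (psi3Term_summable w hq)
  have s3' := ((summable_nat_add_iff 1).2 s3).mul_left (-(w ^ 2)⁻¹)
  have s4 := (psi4Term_summable w hq).mul_left C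
  obtain ⟨K, D, hK, hD, hb⟩ := exists_norm_gTerm_le hq0 hq hw h
  -- The sequence `t` carries the product of the factors `-(w q^k)² q²`, `k < N`.
  have key := tsum_eq_sub_of_telescoping (s3'.add s4) (L := 0)
    (t := fun N => -((-(w ^ 2 * q)) ^ N * q ^ (N ^ 2) * ∑' n, gTerm (w * q ^ N) q n))
    (fun N => ?_) ?_
  · rw [s3'.tsum_add s4, tsum_mul_left, tsum_mul_left] at key
    have h3 : psi3 w q = -w + ∑' n, psi3Term w q (n + 1) := by
      rw [psi3, s3.tsum_eq_zero_add]; simp [psi3Term]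
    have h4 : S4 w q = C * ∑' n, psi4Term w q (n + 1) := rfl
    simp only [pow_zero, mul_one, one_mul, zero_sub, neg_neg, ne_eq, OfNat.ofNat_ne_zero,
      not_false_eq_true, zero_pow] at key
    rw [← key, h3, h4]
    field_simp
    ring
  · have hwN : w * q ^ N ≠ 0 := mul_ne_zero hw (pow_ne_zero _ hq0)
    have fe := tsum_gTerm_add hq0 hq hwN (mul_pow_ne_zpow hq0 h N)
    have hN := qTheta_eq_shift_pow hq0 hq hw N
    have hθN := qTheta_ne_zero hq hwN (mul_pow_ne_zpow hq0 h N)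
    rw [mul_assoc w, ← pow_succ, ← eq_sub_iff_add_eq] at fe
    rw [fe]
    have h5 : 3 * (N + 1) - 2 = 3 * N + 1 := by omega
    have h6 : (3 * (N + 1) ^ 2 - (N + 1)) / 2 = N ^ 2 + 2 * N + 1 + N * (N + 1) / 2 := by
      have : 3 * (N + 1) ^ 2 - (N + 1) = (N ^ 2 + 2 * N + 1) * 2 + N * (N + 1) := by
        apply Nat.sub_eq_of_eq_add; ring
      rw [this]; omega
    rw [psi3Term, psi4Term, h5, h6, hC, hN]
    have h7 : q ^ ((N + 1) ^ 2) = q ^ (N ^ 2) * (q ^ N) ^ 2 * q := by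
      rw [← pow_mul, ← pow_add, ← pow_succ]; congr 1; ring
    have h8 : q ^ (N ^ 2 + 2 * N + 1 + N * (N + 1) / 2) =
        q ^ (N ^ 2) * (q ^ N) ^ 2 * q * q ^ (N * (N + 1) / 2) := by
      rw [pow_add, pow_succ, pow_add, mul_comm 2, pow_mul q N]
    have h9 : w ^ (2 * (N + 1) + 1) = (w ^ N) ^ 2 * w ^ 3 := by
      rw [← pow_mul, ← pow_add]; congr 1; ring
    have h10 : w ^ (3 * N + 1) = (w ^ N) ^ 3 * w := by
      rw [← pow_mul, ← pow_succ]; congr 1; ring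
    have h11 : (-(w ^ 2 * q)) ^ N = (-1) ^ N * ((w ^ N) ^ 2 * q ^ N) := by
      rw [neg_pow, mul_pow, ← pow_mul, ← pow_mul, mul_comm 2]
    have hT : q ^ (N * (N + 1) / 2) ≠ 0 := pow_ne_zero _ hq0
    have hw' : w ^ N ≠ 0 := pow_ne_zero _ hw
    have hone : ((-1 : ℂ) ^ N) ^ 2 = 1 := by rw [← pow_mul, mul_comm, pow_mul]; simp
    rw [neg_pow w N, h7, h8, h9, h10, pow_succ (-(w ^ 2 * q)), h11, pow_succ (-1 : ℂ),
      pow_succ (-1 : ℂ), pow_succ q N]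
    have hne : ((-1 : ℂ) ^ N) ≠ 0 := pow_ne_zero _ (by norm_num)
    generalize (-1 : ℂ) ^ N = ε at *
    generalize w ^ N = y at *
    generalize q ^ N = x at *
    generalize q ^ (N * (N + 1) / 2) = T at *
    field_simp
    linear_combination (x ^ 2 * qPochInf (-q) q * (x * w * q - 1)) * hone
  · simpa using (tendsto_pow_mul_pow_sq_mul (K := K * (1 - ‖q‖)⁻¹) hD (-(w ^ 2 * q)) hq
      fun N => by
        have := norm_tsum_le_of_le_geometric (norm_nonneg q) hq (hb N)
        linarith).neg

/-! ### The series `O_2(w; q⁻¹)` in base `q` -/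

/-- With `z = w⁻¹`, this is the `n`-th term of `O_2(w; q⁻¹)` rewritten in base `q` and divided
by `1 - z`, the factor which completes `(zq)_n` to `(z)_{n+1}`. -/
noncomputable def oTerm (z q : ℂ) (n : ℕ) : ℂ :=
  q ^ n * (qPoch (-1) q n / (qPoch (z⁻¹ * q) q n * qPoch z q (n + 1)))

theorem exists_norm_oTerm_le {z q : ℂ} (hq0 : q ≠ 0) (hq : ‖q‖ < 1) (hz : z ≠ 0)
    (h : ∀ l : ℤ, z ≠ q ^ l) :
    ∃ K D : ℝ, 0 ≤ K ∧ 0 ≤ D ∧ ∀ N n : ℕ, ‖oTerm (z * q ^ N) q n‖ ≤ K * D ^ N * ‖q‖ ^ n := by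
  obtain ⟨K, D, hK, hD, hb⟩ := exists_norm_qPoch_div_le (-1) hq0 hq
    (mul_ne_zero (inv_ne_zero hz) hq0) (by simpa using mul_pow_ne_zpow hq0 (inv_ne_zpow h) 1)
    (b := z) (mul_pow_ne_one_of_forall_ne_zpow h)
  refine ⟨K, D, hK, hD, fun N n => ?_⟩
  rw [oTerm, norm_mul, norm_pow, mul_inv, mul_right_comm _ _ q, mul_comm]
  exact mul_le_mul_of_nonneg_right (hb N n n (n + 1)) (by positivity)

theorem summable_oTerm {z q : ℂ} (hq0 : q ≠ 0) (hq : ‖q‖ < 1) (hz : z ≠ 0)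
    (h : ∀ l : ℤ, z ≠ q ^ l) : Summable (oTerm z q) := by
  obtain ⟨K, D, hK, hD, hb⟩ := exists_norm_oTerm_le hq0 hq hz h
  exact summable_of_le_geometric (K := K) (norm_nonneg q) hq fun n => by simpa using hb 0 n

/-- The normalised sum of `oTerm`; at `z = w⁻¹` it equals `g_{2,2}(w; q⁻¹)`. -/
noncomputable def oSum (z q : ℂ) : ℂ := -(z * (1 + z) / 2) * ∑' n, oTerm z q n - z / 2

/-- The first order `q`-difference equation of `oSum`. -/
theorem oSum_add {z q : ℂ} (hq0 : q ≠ 0) (hq : ‖q‖ < 1) (hz : z ≠ 0)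
    (h : ∀ l : ℤ, z ≠ q ^ l) :
    oSum z q + z ^ 2 * oSum (z * q) q =
      z * (1 - z ^ 2 * q) * qPochInf (-q) q / qTheta z q - z := by
  have h' : ∀ l : ℤ, z * q ≠ q ^ l := by simpa using mul_pow_ne_zpow hq0 h 1
  have hs := (summable_oTerm hq0 hq hz h).mul_left (-(z * (1 + z) / 2))
  have hs' := (summable_oTerm hq0 hq (mul_ne_zero hz hq0) h').mul_left
    (-(z ^ 3 * q * (1 + z * q) / 2))
  have hA := inv_mul_pow_ne_one_of_forall_ne_zpow hz h
  have hB : ∀ k : ℕ, z * q * q ^ k ≠ 1 := mul_pow_ne_one_of_forall_ne_zpow h'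
  have h1 : 1 - z ≠ 0 := sub_ne_zero.2 (by simpa using (h 0).symm)
  have hinf : qPochInf (-1) q = 2 * qPochInf (-q) q := by
    rw [qPochInf_shift (-1) hq]; norm_num
  have key := tsum_eq_sub_of_telescoping (hs.add hs')
    (t := fun n => z * (1 - z ^ 2 * q) / 2 * qPoch (-1) q n /
      (qPoch (z * q) q n * qPoch z⁻¹ q n))
    (L := z * (1 - z ^ 2 * q) / 2 * qPochInf (-1) q / qTheta z q) ?tele ?lim
  · rw [hs.tsum_add hs', tsum_mul_left, tsum_mul_left, hinf] at key
    simp only [qPoch_zero] at key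
    rw [oSum, oSum]
    linear_combination key
  case tele =>
    intro n
    have e2 : qPoch (z⁻¹ * q) q n = qPoch z⁻¹ q n * (1 - z⁻¹ * q ^ n) / (1 - z⁻¹) := by
      rw [← qPoch_succ, qPoch_succ', mul_div_cancel_left₀]
      exact sub_ne_zero.2 (by simpa using (hA 0).symm)
    have e3 : qPoch ((z * q)⁻¹ * q) q n = qPoch z⁻¹ q n := by
      rw [show (z * q)⁻¹ * q = z⁻¹ by field_simp]
    have n1 : qPoch z⁻¹ q n ≠ 0 := qPoch_ne_zero hA n
    have n2 : qPoch (z * q) q n ≠ 0 := qPoch_ne_zero hB n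
    have n3 : z - q ^ n ≠ 0 := by
      rw [sub_ne_zero]; intro hn; exact h n (by simpa using hn)
    have n4 : 1 - z * q * q ^ n ≠ 0 := sub_ne_zero.2 (hB n).symm
    have n5 : 1 - z⁻¹ = -((1 - z) / z) := by field_simp; ring
    have n6 : 1 - z⁻¹ * q ^ n = (z - q ^ n) / z := by field_simp
    simp only [oTerm, e2, e3, n5, qPoch_succ z⁻¹, qPoch_succ (-1), n6,
      qPoch_succ (z * q), qPoch_succ' z]
    generalize qPoch z⁻¹ q n = A at *
    generalize qPoch (z * q) q n = B at *
    generalize qPoch (-1) q n = P at *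
    generalize q ^ n = x at *
    generalize hE : 1 - z = E at *
    generalize hG : 1 - z * q * x = G at *
    generalize hH : z - x = H at *
    field_simp
    rw [← hG, ← hH]
    ring
  case lim =>
    exact ((tendsto_qPoch (-1) hq).const_mul _).div ((tendsto_qPoch (z * q) hq).mul
      (tendsto_qPoch z⁻¹ hq)) (qTheta_ne_zero hq hz h)

/-! ### The series `ψ_1` without Kronecker symbols -/

theorem kronecker12_eq_zero {n : ℕ} (h : ¬ n.Coprime 6) : kronecker12 n = 0 := by
  rw [kronecker12, ite_eq_left_iff]
  intro hn
  have : NeZero n := ⟨hn⟩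
  refine jacobiSym.eq_zero_iff_not_coprime.2 fun h1 => h ?_
  have h2 : Nat.Coprime 12 n := h1
  exact (Nat.Coprime.coprime_dvd_left (by norm_num) h2).symm

theorem kronecker12_eq_of_mod {n k r : ℕ} (hr : r < 6) (hn : n = 6 * k + r) (hodd : r % 2 = 1)
    (h3 : r % 3 ≠ 0) : kronecker12 n = if r = 1 then (-1) ^ k else -(-1) ^ k := by
  have h0 : n ≠ 0 := by omega
  have hmod : n % 48 = 6 * (k % 8) + r := by omega
  have hk : ((-1 : ℤ)) ^ k = (-1) ^ (k % 8) := by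
    conv_lhs => rw [← Nat.div_add_mod k 8, pow_add, pow_mul]
    norm_num
  rw [kronecker12, if_neg h0, jacobiSym.mod_right 12 (Nat.odd_iff.2 (by omega)), hk]
  rw [show 4 * (12 : ℤ).natAbs = 48 from rfl, hmod]
  -- The symbol has period `48`, which leaves eight values of `k` in each residue class.
  have : k % 8 < 8 := Nat.mod_lt _ (by norm_num)
  interval_cases k % 8 <;> interval_cases r <;> first | omega | norm_num

/-- The series of `ψ_1`, summed over the residue classes `±1` modulo `6`. -/
theorem hasSum_psi1 (z : ℂ) {q : ℂ} (hq : ‖q‖ < 1) :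
    HasSum (fun k : ℕ => z ^ (3 * k) * q ^ (k * (3 * k + 1) / 2) * (1 - z ^ 2 * q ^ (2 * k + 1)))
      (∑' n, psi1Term (-z) q n) := by
  have hs := psi1Term_summable (-z) hq
  have hterm : ∀ k : ℕ,
      z ^ (3 * k) * q ^ (k * (3 * k + 1) / 2) * (1 - z ^ 2 * q ^ (2 * k + 1)) =
        psi1Term (-z) q (6 * k + 1) + psi1Term (-z) q (6 * k + 5) := fun k => by
    have hpar : k * (3 * k + 1) / 2 * 2 = k * (3 * k + 1) := by
      refine Nat.div_mul_cancel ?_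
      rcases Nat.even_or_odd' k with ⟨m, rfl | rfl⟩
      · exact ⟨m * (3 * (2 * m) + 1), by ring⟩
      · exact ⟨(2 * m + 1) * (3 * m + 2), by ring⟩
    have e1 : ((6 * k + 1) ^ 2 - 1) / 24 = k * (3 * k + 1) / 2 := by
      have : (6 * k + 1) ^ 2 = 12 * (k * (3 * k + 1)) + 1 := by ring
      omega
    have e2 : ((6 * k + 5) ^ 2 - 1) / 24 = k * (3 * k + 1) / 2 + (2 * k + 1) := by
      have : (6 * k + 5) ^ 2 = 12 * (k * (3 * k + 1)) + 48 * k + 25 := by ring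
      omega
    have e3 : (6 * k + 1 - 1) / 2 = 3 * k := by omega
    have e4 : (6 * k + 5 - 1) / 2 = 3 * k + 2 := by omega
    have hsgn : ((-1 : ℂ) ^ k) * (-1) ^ (3 * k) = 1 := by
      rw [← pow_add, show k + 3 * k = 2 * (2 * k) by ring, pow_mul]; simp
    rw [psi1Term, psi1Term, kronecker12_eq_of_mod (k := k) (r := 1) (by norm_num) rfl rfl
      (by norm_num), kronecker12_eq_of_mod (k := k) (r := 5) (by norm_num) rfl rfl (by norm_num),
      e1, e2, e3, e4, pow_add (-z), neg_pow z (3 * k), pow_add q]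
    push_cast
    norm_num
    linear_combination (-(z ^ (3 * k) * q ^ (k * (3 * k + 1) / 2) *
      (1 - z ^ 2 * q ^ (2 * k + 1)))) * hsgn
  simp_rw [hterm]
  have i1 : Function.Injective fun k : ℕ => 6 * k + 1 := fun a b h => by simpa using h
  have i2 : Function.Injective fun k : ℕ => 6 * k + 5 := fun a b h => by simpa using h
  have hs' := (hs.comp_injective i1).add (hs.comp_injective i2)
  suffices heq : ∑' n, psi1Term (-z) q n =
      ∑' k, (psi1Term (-z) q (6 * k + 1) + psi1Term (-z) q (6 * k + 5)) from heq ▸ hs'.hasSum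
  refine tendsto_nhds_unique (hs.hasSum.tendsto_sum_nat.comp
    (tendsto_id.const_mul_atTop' (show 0 < 6 by norm_num))) ?_
  refine hs'.hasSum.tendsto_sum_nat.congr fun K => ?_
  have hz : ∀ n : ℕ, ¬ n.Coprime 6 → psi1Term (-z) q n = 0 := fun n hn => by
    simp [psi1Term, kronecker12_eq_zero hn]
  simp only [Function.comp, id]
  induction K with
  | zero => simp
  | succ K ih =>
    have c0 := hz (6 * K) (by simp)
    have c2 := hz (6 * K + 2) fun h => by
      have := Nat.dvd_gcd (show 2 ∣ 6 * K + 2 by omega) (show 2 ∣ 6 by norm_num)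
      rw [h] at this; omega
    have c3 := hz (6 * K + 3) fun h => by
      have := Nat.dvd_gcd (show 3 ∣ 6 * K + 3 by omega) (show 3 ∣ 6 by norm_num)
      rw [h] at this; omega
    have c4 := hz (6 * K + 4) fun h => by
      have := Nat.dvd_gcd (show 2 ∣ 6 * K + 4 by omega) (show 2 ∣ 6 by norm_num)
      rw [h] at this; omega
    rw [Finset.sum_range_succ, ih, show 6 * (K + 1) = 6 * K + 6 by ring]
    simp only [Finset.sum_range_succ _ (6 * K + 5), Finset.sum_range_succ _ (6 * K + 4),
      Finset.sum_range_succ _ (6 * K + 3), Finset.sum_range_succ _ (6 * K + 2),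
      Finset.sum_range_succ _ (6 * K + 1), Finset.sum_range_succ _ (6 * K), c0, c2, c3, c4]
    ring

/-! ### Evaluation of `oSum` -/

/-- Iteration of `oSum_add` along `z, zq, zq², …`. -/
theorem oSum_eq {z q : ℂ} (hq0 : q ≠ 0) (hq : ‖q‖ < 1) (hz : z ≠ 0)
    (h : ∀ l : ℤ, z ≠ q ^ l) :
    oSum z q = psi3 z q + S1 (-z) q := by
  set C := qPochInf (-q) q / qTheta z q with hC
  have hθ := qTheta_ne_zero hq hz h
  have s3 := psi3Term_summable z hq
  have s1 := (hasSum_psi1 z hq).mul_left (C * z)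
  obtain ⟨K, D, hK, hD, hb⟩ := exists_norm_oTerm_le hq0 hq hz h
  -- The sequence `t` carries the product of the factors `-(z q^k)²`, `k < N`.
  have key := tsum_eq_sub_of_telescoping (s3.add s1.summable) (L := 0)
    (t := fun N => -((-(z ^ 2 / q)) ^ N * q ^ (N ^ 2) * oSum (z * q ^ N) q))
    (fun N => ?_) ?_
  · rw [s3.tsum_add s1.summable, s1.tsum_eq] at key
    have h1 : S1 (-z) q = C * (z * ∑' n, psi1Term (-z) q n) := by
      rw [S1, psi1, hC, qTheta, inv_neg, neg_neg, neg_mul, neg_neg, mul_comm (qPochInf z⁻¹ q)]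
      congr 1
      field_simp
      ring
    simp only [pow_zero, mul_one, one_mul, zero_sub, neg_neg, ne_eq, OfNat.ofNat_ne_zero,
      not_false_eq_true, zero_pow] at key
    rw [← key, h1, psi3, mul_assoc]
  · have hzN : z * q ^ N ≠ 0 := mul_ne_zero hz (pow_ne_zero _ hq0)
    have fe := oSum_add hq0 hq hzN (mul_pow_ne_zpow hq0 h N)
    have hN := qTheta_eq_shift_pow hq0 hq hz N
    have hθN := qTheta_ne_zero hq hzN (mul_pow_ne_zpow hq0 h N)
    rw [mul_assoc z, ← pow_succ, ← eq_sub_iff_add_eq] at fe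
    rw [fe]
    have h6 : N * (3 * N + 1) / 2 = N ^ 2 + N * (N + 1) / 2 := by
      have : N * (3 * N + 1) = N ^ 2 * 2 + N * (N + 1) := by ring
      omega
    rw [psi3Term, h6, hC, hN]
    have h7 : q ^ ((N + 1) ^ 2) = q ^ (N ^ 2) * (q ^ N) ^ 2 * q := by
      rw [← pow_mul, ← pow_add, ← pow_succ]; congr 1; ring
    have h8 : q ^ (2 * N + 1) = (q ^ N) ^ 2 * q := by rw [pow_succ, mul_comm 2, pow_mul]
    have h9 : z ^ (2 * N + 1) = (z ^ N) ^ 2 * z := by rw [pow_succ, mul_comm 2, pow_mul]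
    have h10 : z ^ (3 * N) = (z ^ N) ^ 3 := by rw [mul_comm 3, pow_mul]
    have h11 : (-(z ^ 2 / q)) ^ N = (-1) ^ N * ((z ^ N) ^ 2 / q ^ N) := by
      rw [neg_pow, div_pow, ← pow_mul, ← pow_mul, mul_comm 2]
    have hT : q ^ (N * (N + 1) / 2) ≠ 0 := pow_ne_zero _ hq0
    have hz' : z ^ N ≠ 0 := pow_ne_zero _ hz
    have hx : q ^ N ≠ 0 := pow_ne_zero _ hq0
    have hone : ((-1 : ℂ) ^ N) ^ 2 = 1 := by rw [← pow_mul, mul_comm, pow_mul]; simp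
    rw [neg_pow z N, h7, pow_add q (N ^ 2), h8, h9, h10, pow_succ (-(z ^ 2 / q)), h11,
      pow_succ (-1 : ℂ)]
    have hne : ((-1 : ℂ) ^ N) ≠ 0 := pow_ne_zero _ (by norm_num)
    generalize oSum (z * q ^ (N + 1)) q = F at *
    generalize (-1 : ℂ) ^ N = ε at *
    generalize z ^ N = y at *
    generalize q ^ N = x at *
    generalize q ^ (N * (N + 1) / 2) = T at *
    field_simp
    linear_combination (qPochInf (-q) q * (z ^ 2 * q * x ^ 2 - 1)) * hone
  · refine (neg_zero (G := ℂ)) ▸ (tendsto_pow_mul_pow_sq_mul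
      (K := ‖z‖ * (1 + ‖z‖) / 2 * (K * (1 - ‖q‖)⁻¹) + ‖z‖ / 2)
      (D := max D 1) (by positivity) (-(z ^ 2 / q)) hq fun N => ?_).neg
    have h1 := norm_tsum_le_of_le_geometric (norm_nonneg q) hq (hb N)
    have h2 : ‖z * q ^ N‖ ≤ ‖z‖ := by
      rw [norm_mul, norm_pow]
      exact mul_le_of_le_one_right (norm_nonneg _) (pow_le_one₀ (norm_nonneg _) hq.le)
    have h3 : ‖1 + z * q ^ N‖ ≤ 1 + ‖z‖ := (norm_add_le _ _).trans (by simpa using h2)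
    have h4 : D ^ N ≤ (max D 1) ^ N := pow_le_pow_left₀ hD (le_max_left _ _) N
    have h5 : 1 ≤ (max D 1) ^ N := one_le_pow₀ (le_max_right _ _)
    have h6 : 0 ≤ (1 - ‖q‖)⁻¹ := inv_nonneg.2 (by linarith)
    rw [oSum]
    refine (norm_sub_le _ _).trans ?_
    rw [norm_mul, norm_neg, norm_div, norm_mul, norm_div, Complex.norm_ofNat]
    calc _ ≤ ‖z‖ * (1 + ‖z‖) / 2 * (K * (max D 1) ^ N * (1 - ‖q‖)⁻¹) +
          ‖z‖ / 2 * (max D 1) ^ N := by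
          refine add_le_add ?_ ?_
          · refine mul_le_mul ?_ (h1.trans ?_) (norm_nonneg _) (by positivity)
            · gcongr
            · gcongr
          · exact (div_le_div_of_nonneg_right h2 (by norm_num)).trans
              (le_mul_of_one_le_right (by positivity) h5)
      _ = _ := by ring

/-! ### The series `g_{2,3}(w; q⁻¹)` in base `q` -/

/-- With `z = w⁻¹`, the `n`-th term of the series in `g_{2,3}(w; q⁻¹)`, rewritten in base `q`. -/
noncomputable def rTerm (z q : ℂ) (n : ℕ) : ℂ :=
  (-z) ^ n * (qPoch (-(z * q)) q n / qPoch (z * q) q n)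

theorem mul_pow_ne_one_of_norm_lt_one {z q : ℂ} (hq : ‖q‖ < 1) (hz : ‖z‖ < 1) (k : ℕ) :
    z * q ^ k ≠ 1 := fun hk => by
  have h1 : ‖z * q ^ k‖ < 1 := by
    rw [norm_mul, norm_pow]
    exact mul_lt_one_of_nonneg_of_lt_one_left (norm_nonneg _) hz
      (pow_le_one₀ (norm_nonneg _) hq.le)
  rw [hk, norm_one] at h1
  exact lt_irrefl _ h1

theorem exists_norm_rTerm_le {z q : ℂ} (hq : ‖q‖ < 1) (hz : ‖z‖ < 1) :
    ∃ K : ℝ, 0 ≤ K ∧ ∀ N n : ℕ, ‖rTerm (z * q ^ N) q n‖ ≤ K * ‖z‖ ^ n := by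
  have hzq : ‖z * q‖ < 1 := by
    rw [norm_mul]; exact mul_lt_one_of_nonneg_of_lt_one_left (norm_nonneg _) hz hq.le
  have hb : ∀ k : ℕ, -(z * q) * q ^ k ≠ 1 :=
    mul_pow_ne_one_of_norm_lt_one hq (by rwa [norm_neg])
  obtain ⟨C, hC, hC'⟩ := exists_norm_qPoch_le (-(z * q)) hq
  obtain ⟨b, hb, hb'⟩ := exists_le_norm_qPoch hq hb
  obtain ⟨c, hc, hc'⟩ := exists_le_norm_qPoch_mul_pow hq (mul_pow_ne_one_of_norm_lt_one hq hzq)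
  refine ⟨C / b / c, by positivity, fun N n => ?_⟩
  have h1 : ‖qPoch (-(z * q) * q ^ N) q n‖ ≤ C / b := by
    have h2 := hC' (N + n)
    rw [qPoch_add, norm_mul] at h2
    rw [le_div_iff₀' hb]
    exact (mul_le_mul_of_nonneg_right (hb' N) (norm_nonneg _)).trans h2
  have h3 : ‖-(z * q ^ N)‖ ≤ ‖z‖ := by
    rw [norm_neg, norm_mul, norm_pow]
    exact mul_le_of_le_one_right (norm_nonneg _) (pow_le_one₀ (norm_nonneg _) hq.le)
  rw [rTerm, norm_mul, norm_pow, norm_div, mul_right_comm z, ← neg_mul (z * q), mul_comm]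
  have h4 := hc' N n
  gcongr

theorem summable_rTerm {z q : ℂ} (hq : ‖q‖ < 1) (hz : ‖z‖ < 1) : Summable (rTerm z q) := by
  obtain ⟨K, hK, hb⟩ := exists_norm_rTerm_le hq hz
  exact summable_of_le_geometric (K := K) (norm_nonneg z) hz fun n => by simpa using hb 0 n

/-- The normalised sum of `rTerm`; at `z = w⁻¹` it equals `g_{2,3}(w; q⁻¹)`. -/
noncomputable def rSum (z q : ℂ) : ℂ := -(z * (1 + z) / 2) * ∑' n, rTerm z q n - z / 2

/-- The first order `q`-difference equation of `rSum`. It is the one of `ψ_3`, with no theta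
quotient, because the telescoping sequence tends to `0` when `|z| < 1`. -/
theorem rSum_add {z q : ℂ} (hq : ‖q‖ < 1) (hz : ‖z‖ < 1) :
    rSum z q + z ^ 2 * rSum (z * q) q = -z := by
  have hzq : ‖z * q‖ < 1 := by
    rw [norm_mul]; exact mul_lt_one_of_nonneg_of_lt_one_left (norm_nonneg _) hz hq.le
  have hs0 := summable_rTerm hq hz
  have hs := hs0.mul_left (-(z * (1 + z) / 2))
  have hs' := (summable_rTerm hq hzq).mul_left (-(z ^ 3 * q * (1 + z * q) / 2))
  have hB : ∀ k : ℕ, z * q * q ^ k ≠ 1 := mul_pow_ne_one_of_norm_lt_one hq hzq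
  have hB' : ∀ k : ℕ, -(z * q) * q ^ k ≠ 1 :=
    mul_pow_ne_one_of_norm_lt_one hq (by rwa [norm_neg])
  have key := tsum_eq_sub_of_telescoping (hs.add hs')
    (t := fun n => z / 2 * (1 - z ^ 2 * q * q ^ n) * rTerm z q n)
    (L := z / 2 * (1 - z ^ 2 * q * 0) * 0) ?tele ?lim
  · rw [hs.tsum_add hs', tsum_mul_left, tsum_mul_left] at key
    simp only [rTerm, qPoch_zero] at key
    rw [rSum, rSum]
    simp only [rTerm]
    linear_combination key
  case tele =>
    intro n
    have n2 : qPoch (z * q) q n ≠ 0 := qPoch_ne_zero hB n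
    have n4 : 1 - z * q * q ^ n ≠ 0 := sub_ne_zero.2 (hB n).symm
    have n3 : 1 - z * q ≠ 0 := sub_ne_zero.2 (by simpa using (hB 0).symm)
    have n5 : 1 + z * q ≠ 0 := by
      have := sub_ne_zero.2 (hB' 0).symm
      simpa using this
    have e1 : qPoch (z * q * q) q n = qPoch (z * q) q n * (1 - z * q * q ^ n) / (1 - z * q) := by
      rw [← qPoch_succ, qPoch_succ', mul_div_cancel_left₀ _ n3]
    have e2 : qPoch (-(z * q * q)) q n =
        qPoch (-(z * q)) q n * (1 + z * q * q ^ n) / (1 + z * q) := by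
      have := qPoch_succ (-(z * q)) q n
      rw [qPoch_succ'] at this
      rw [eq_div_iff n5, ← neg_mul, mul_comm, ← sub_neg_eq_add 1 (z * q), this]
      ring
    have e3 : (-(z * q)) ^ n = (-z) ^ n * q ^ n := by rw [← mul_pow, neg_mul]
    simp only [rTerm, e1, e2, e3, qPoch_succ, pow_succ q n, pow_succ (-z) n]
    generalize qPoch (z * q) q n = B at *
    generalize (-z) ^ n = y at *
    generalize qPoch (-(z * q)) q n = P at *
    generalize q ^ n = x at *
    generalize hG : 1 - z * q * x = G at *
    generalize hE : 1 - z * q = E at *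
    generalize hH : 1 + z * q = H at *
    field_simp
    rw [← hG, ← hE]
    ring
  case lim =>
    exact ((((tendsto_pow_atTop_nhds_zero_of_norm_lt_one hq).const_mul _).const_sub 1).const_mul
      _).mul hs0.tendsto_atTop_zero

/-- Iteration of `rSum_add` along `z, zq, zq², …`. -/
theorem rSum_eq {z q : ℂ} (hq : ‖q‖ < 1) (hq0 : q ≠ 0) (hz : ‖z‖ < 1) :
    rSum z q = psi3 z q := by
  have s3 := psi3Term_summable z hq
  obtain ⟨K, hK, hb⟩ := exists_norm_rTerm_le hq hz
  have hzN : ∀ N : ℕ, ‖z * q ^ N‖ ≤ ‖z‖ := fun N => by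
    rw [norm_mul, norm_pow]
    exact mul_le_of_le_one_right (norm_nonneg _) (pow_le_one₀ (norm_nonneg _) hq.le)
  have key := tsum_eq_sub_of_telescoping s3 (L := 0)
    (t := fun N => -((-(z ^ 2 / q)) ^ N * q ^ (N ^ 2) * rSum (z * q ^ N) q))
    (fun N => ?_) ?_
  · simp only [pow_zero, mul_one, one_mul, zero_sub, neg_neg, ne_eq, OfNat.ofNat_ne_zero,
      not_false_eq_true, zero_pow] at key
    rw [← key, psi3]
  · have fe := rSum_add hq ((hzN N).trans_lt hz)
    rw [mul_assoc z, ← pow_succ, ← eq_sub_iff_add_eq] at fe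
    rw [fe, psi3Term]
    have h7 : q ^ ((N + 1) ^ 2) = q ^ (N ^ 2) * (q ^ N) ^ 2 * q := by
      rw [← pow_mul, ← pow_add, ← pow_succ]; congr 1; ring
    have h9 : z ^ (2 * N + 1) = (z ^ N) ^ 2 * z := by rw [pow_succ, mul_comm 2, pow_mul]
    have h11 : (-(z ^ 2 / q)) ^ N = (-1) ^ N * ((z ^ N) ^ 2 / q ^ N) := by
      rw [neg_pow, div_pow, ← pow_mul, ← pow_mul, mul_comm 2]
    rw [h7, h9, pow_succ (-(z ^ 2 / q)), h11, pow_succ (-1 : ℂ)]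
    field_simp
    ring
  · refine (neg_zero (G := ℂ)) ▸ (tendsto_pow_mul_pow_sq_mul
      (K := ‖z‖ * (1 + ‖z‖) / 2 * (K * (1 - ‖z‖)⁻¹) + ‖z‖ / 2)
      (D := 1) zero_le_one (-(z ^ 2 / q)) hq fun N => ?_).neg
    have h1 := norm_tsum_le_of_le_geometric (norm_nonneg z) hz (hb N)
    have h2 := hzN N
    have h3 : ‖1 + z * q ^ N‖ ≤ 1 + ‖z‖ := (norm_add_le _ _).trans (by simpa using h2)
    rw [rSum]
    refine (norm_sub_le _ _).trans ?_
    rw [norm_mul, norm_neg, norm_div, norm_mul, norm_div, Complex.norm_ofNat, one_pow, mul_one]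
    gcongr

/-! ### From base `q⁻¹` to base `q` -/

/-- Inversion of the base; the exponent of `q` is `n (n - 1) / 2`. -/
theorem qPoch_inv_base {a q : ℂ} (hq0 : q ≠ 0) (ha : a ≠ 0) (n : ℕ) :
    qPoch a q⁻¹ n = (-a) ^ n * (q ^ n.choose 2)⁻¹ * qPoch a⁻¹ q n := by
  induction n with
  | zero => simp [qPoch_zero]
  | succ n ih =>
    rw [qPoch_succ, qPoch_succ, ih, Nat.choose_succ_succ' n 1, Nat.choose_one_right, pow_add,
      inv_pow, pow_succ]
    field_simp
    ring

theorem triangle_eq_add_choose (n : ℕ) : n * (n + 1) / 2 = n + n.choose 2 := by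
  have := Nat.choose_two_right (n + 1)
  rw [Nat.choose_succ_succ' n 1, Nat.choose_one_right, Nat.add_sub_cancel, mul_comm] at this
  exact this.symm

theorem g2Term_inv_base {w q : ℂ} (hq0 : q ≠ 0) (hw : w ≠ 0) (n : ℕ) :
    g2Term w q⁻¹ n = gTerm w q n := by
  have e1 : (w⁻¹ * q⁻¹)⁻¹ = w * q := by simp [mul_comm]
  have e2 : (-q⁻¹)⁻¹ = -q := by simp
  have e3 : (-w) ^ (n + 1) * (-(w⁻¹ * q⁻¹)) ^ (n + 1) = (q ^ (n + 1))⁻¹ := by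
    rw [← mul_pow, ← inv_pow]; congr 1; field_simp
  have hT : q ^ n.choose 2 ≠ 0 := pow_ne_zero _ hq0
  have hn : q ^ n ≠ 0 := pow_ne_zero _ hq0
  rw [g2Term, gTerm, qPoch_inv_base hq0 (neg_ne_zero.2 (inv_ne_zero hq0)),
    qPoch_inv_base hq0 hw, qPoch_inv_base hq0 (mul_ne_zero (inv_ne_zero hw) (inv_ne_zero hq0)),
    e1, e2, triangle_eq_add_choose, Nat.choose_succ_succ' n 1, Nat.choose_one_right, neg_neg,
    mul_mul_mul_comm, mul_mul_mul_comm ((-w) ^ (n + 1)), e3]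
  simp only [pow_add, inv_pow, pow_one]
  field_simp

theorem O2Term_inv_base {w q : ℂ} (hq0 : q ≠ 0) (hw : w ≠ 0) (hw1 : w ≠ 1) (n : ℕ) :
    O2Term w q⁻¹ n = (1 - w⁻¹) * oTerm w⁻¹ q n := by
  have e1 : (w⁻¹ * q⁻¹)⁻¹ = w * q := by simp [mul_comm]
  have e2 : (w * q⁻¹)⁻¹ = w⁻¹ * q := by simp [mul_comm]
  have e3 : (-(w * q⁻¹)) ^ n * (-(w⁻¹ * q⁻¹)) ^ n = (q ^ n)⁻¹ * (q ^ n)⁻¹ := by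
    rw [← mul_pow, ← inv_pow, ← mul_pow]; congr 1; field_simp
  have hT : q ^ n.choose 2 ≠ 0 := pow_ne_zero _ hq0
  have hn : q ^ n ≠ 0 := pow_ne_zero _ hq0
  have h1 : 1 - w⁻¹ ≠ 0 := sub_ne_zero.2 fun h => hw1 (inv_eq_one.1 h.symm)
  rw [O2Term, oTerm, qPoch_inv_base hq0 (neg_ne_zero.2 one_ne_zero),
    qPoch_inv_base hq0 (mul_ne_zero hw (inv_ne_zero hq0)),
    qPoch_inv_base hq0 (mul_ne_zero (inv_ne_zero hw) (inv_ne_zero hq0)),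
    e1, e2, triangle_eq_add_choose, neg_neg, one_pow, one_mul, inv_neg_one, inv_inv,
    qPoch_succ' w⁻¹, mul_mul_mul_comm, mul_mul_mul_comm ((-(w * q⁻¹)) ^ n), e3]
  simp only [pow_add, inv_pow]
  field_simp

theorem g23Term_inv_base {w q : ℂ} (hq0 : q ≠ 0) (hw : w ≠ 0) (n : ℕ) :
    g23Term w q⁻¹ n = rTerm w⁻¹ q n := by
  have e1 : (-(w * q⁻¹))⁻¹ = -(w⁻¹ * q) := by rw [inv_neg]; simp [mul_comm]
  have e2 : (w * q⁻¹)⁻¹ = w⁻¹ * q := by simp [mul_comm]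
  have h0 : w * q⁻¹ ≠ 0 := mul_ne_zero hw (inv_ne_zero hq0)
  have hT : q ^ n.choose 2 ≠ 0 := pow_ne_zero _ hq0
  have h1 : (w * q⁻¹) ^ n ≠ 0 := pow_ne_zero _ h0
  have hone : ((-1 : ℂ) ^ n)⁻¹ = (-1) ^ n := by rw [← inv_pow, inv_neg_one]
  rw [g23Term, rTerm, qPoch_inv_base hq0 (neg_ne_zero.2 h0), qPoch_inv_base hq0 h0, e1, e2,
    neg_neg, neg_pow (w * q⁻¹), neg_pow w⁻¹, mul_div_mul_comm,
    mul_div_mul_right _ _ (inv_ne_zero hT), div_mul_cancel_right₀ h1, hone]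
  ring

theorem mainTheorem4 (q : ℂ) (hq0 : q ≠ 0) (hq : ‖q‖ < 1) :
    (∀ w : ℂ, w ≠ 0 → (∀ l : ℤ, w ≠ q ^ l) →
      (Summable (g2Term w q⁻¹) ∧
        g21 w q⁻¹ = -(w ^ 2)⁻¹ * psi3 w q - w⁻¹ + S4 w q) ∧
      (Summable (O2Term w q⁻¹) ∧
        g22 w q⁻¹ = psi3 w⁻¹ q + S1 (-w⁻¹) q)) ∧
    (∀ w : ℂ, (∀ l : ℕ, 1 ≤ l → w ≠ q ^ l) → 1 < ‖w‖ →
      Summable (g23Term w q⁻¹) ∧ g23 w q⁻¹ = psi3 w⁻¹ q) := by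
  refine ⟨fun w hw h => ⟨?_, ?_⟩, fun w _ hw1 => ?_⟩
  · have e : g2Term w q⁻¹ = gTerm w q := funext (g2Term_inv_base hq0 hw)
    rw [g21, e]
    exact ⟨summable_gTerm hq0 hq hw h, tsum_gTerm_eq hq0 hq hw h⟩
  · have hw1 : w ≠ 1 := by simpa using h 0
    have e : O2Term w q⁻¹ = fun n => (1 - w⁻¹) * oTerm w⁻¹ q n :=
      funext (O2Term_inv_base hq0 hw hw1)
    have h' := inv_ne_zpow h
    have hd : 1 - w ≠ 0 := sub_ne_zero.2 hw1.symm
    rw [g22, O2, e, tsum_mul_left, ← oSum_eq hq0 hq (inv_ne_zero hw) h', oSum]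
    refine ⟨(summable_oTerm hq0 hq (inv_ne_zero hw) h').mul_left _, ?_⟩
    generalize ∑' n, oTerm w⁻¹ q n = U
    field_simp
    ring
  · have hw : w ≠ 0 := norm_pos_iff.1 (one_pos.trans hw1)
    have hz : ‖w⁻¹‖ < 1 := by rw [norm_inv]; exact inv_lt_one_of_one_lt₀ hw1
    have e : g23Term w q⁻¹ = rTerm w⁻¹ q := funext (g23Term_inv_base hq0 hw)
    rw [g23, e, ← rSum_eq hq hq0 hz, rSum]
    refine ⟨summable_rTerm hq hz, ?_⟩
    generalize ∑' n, rTerm w⁻¹ q n = U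
    field_simp
    ring
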